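/- Let $\Omega=C^3(\mathbb{R}^d;\mathbb{R})$ with its Fréchet topology (locally uniform convergence of derivatives up to order 3) and Borel $\sigma$-algebra, and $\tau_x h=h(\cdot+x)$. Let $\mathbb{P}$ be a Borel probability measure on $\Omega$ which is invariant under all $\tau_x$, ergodic (every Borel set $B$ with $\tau_x(B)=B$ for all $x$ has probability $0$ or $1$), stochastically continuous ($\tau_x h\to h$ in $\mathbb{P}$-probability as $x\to0$), and such that for some constant $K>0$, $\mathbb{P}$-a.s., $|\nabla h(x)|+|\nabla\nabla h(x)|\le K$ for all $x\in\mathbb{R}^d$. Put $g(x,h)=I+\nabla h(x)\otimes\nabla h(x)$, $|g|=\det g$, $g(h)=g(0,h)$, $Z=\int\sqrt{|g|(h)}\,\mathbb{P}(dh)$, $\pi(dh)=Z^{-1}\sqrt{|g|(h)}\,\mathbb{P}(dh)$, and for $e\in\mathbb{R}^d$ let $F^e(h)=e\cdot\big(|g|^{-1/2}\,\nabla_x\cdot(\sqrt{|g|}\,g^{-1})\big)(0,h)$. Let $D_iV=\frac{d}{dt}V(\tau_{te_i}h)|_{t=0}$ in $L^2(\mathbb{P})$, $H^1=\bigcap_i\mathcal{D}(D_i)$,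 and $\mathbb{D}V=(D_iV)_{i=1}^d$ for $V\in H^1$. Let $\mathcal{L}$ be the self-adjoint operator on $L^2(\pi)$ given by the Dirichlet form $\langle-\mathcal{L}u,v\rangle_{L^2(\pi)}=\frac1Z\int_\Omega\mathbb{D}u\cdot g^{-1}\mathbb{D}v\,\sqrt{|g|}\,d\mathbb{P}$ with domain $H^1$. Let $\mathcal{H}_1$ be the Hausdorff completion of $H^1$ in the seminorm $\|\phi\|_1=\langle-\mathcal{L}\phi,\phi\rangle_{L^2(\pi)}^{1/2}$ (understood as the form), to which $\mathbb{D}$ extends continuously with values in $(L^2(\mathbb{P}))^d$. Let $L^2_{pot}(\mathbb{P})$ be the closure in $(L^2(\mathbb{P}))^d$ of $\mathbb{D}(H^1)$, $L^2_c(\mathbb{P})$ the space of constant vector fields, and $L^2_{div}(\mathbb{P})$ the orthogonal complement of $L^2_c(\mathbb{P})\oplus L^2_{pot}(\mathbb{P})$ in $(L^2(\mathbb{P}))^d$. **Proposition 5.1.** Let $e\in\mathbb{R}^d$ with $|e|=1$. There is a unique $\chi^e\in\mathcal{H}_1$ which is the limit in $\mathcal{H}_1$, as $\lambda\downarrow0$,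 of solutions $\chi^e_\lambda$ of $(\lambda-\mathcal{L})\chi^e_\lambda=F^e$ ($\lambda>0$), and $V=\mathbb{D}\chi^e$ is the unique $V\in(L^2(\mathbb{P}))^d$ such that $$V\in L^2_{pot}(\mathbb{P}),\qquad \sqrt{|g|}\,g^{-1}(e+V)\in L^2_{div}(\mathbb{P})\oplus L^2_c(\mathbb{P}).$$ -/

import Mathlib

open MeasureTheory Filter Topology
open scoped Matrix

noncomputable section

namespace RandomSurface

/-- The coordinate space `ℝ^d` with its Euclidean norm. -/
abbrev Space (d : ℕ) : Type := EuclideanSpace ℝ (Fin d)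

/-- The `i`-th coordinate vector of `ℝ^d`. -/
abbrev basisVec {d : ℕ} (i : Fin d) : Space d := EuclideanSpace.single i (1 : ℝ)

/-! ## The space `Ω = C³(ℝ^d)` of surfaces -/

/-- `Ω`: the `C³` functions `ℝ^d → ℝ`; the surface is the graph of `h`. -/
structure Surface (d : ℕ) where
  /-- the height function -/
  toFun : Space d → ℝ
  /-- it is three times continuously differentiable -/
  contDiff' : ContDiff ℝ 3 toFun

variable {d : ℕ}

instance : CoeFun (Surface d) (fun _ => Space d → ℝ) := ⟨Surface.toFun⟩

theorem Surface.contDiff (h : Surface d) : ContDiff ℝ 3 (fun x => h x) := h.contDiff'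

/-- The `k`-th derivative of `h`, `k ≤ 3`, as a continuous map. -/
def Surface.jet (k : Fin 4) (h : Surface d) :
    C(Space d, ContinuousMultilinearMap ℝ (fun _ : Fin (k : ℕ) => Space d) ℝ) where
  toFun := iteratedFDeriv ℝ (k : ℕ) (fun x => h x)
  continuous_toFun := h.contDiff.continuous_iteratedFDeriv
    (by exact_mod_cast Nat.lt_succ_iff.mp k.isLt)

/-- The Fréchet topology of `Ω`: locally uniform convergence of the derivatives of order `≤ 3`,
i.e. the topology of the seminorms `frechetSeminorm N` below. -/
instance : TopologicalSpace (Surface d) :=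
  ⨅ k : Fin 4, TopologicalSpace.induced (Surface.jet k) inferInstance

/-- `Ω` carries its Borel `σ`-algebra. -/
instance : MeasurableSpace (Surface d) := borel (Surface d)

instance : BorelSpace (Surface d) := ⟨rfl⟩

/-- `‖f‖_N = sup_{|x| ≤ N} ∑_{k ≤ 3} |∇^k f(x)|`. -/
def frechetSeminorm (N : ℕ) (f : Space d → ℝ) : ℝ :=
  ⨆ x : Metric.closedBall (0 : Space d) (N : ℝ),
    ∑ k ∈ Finset.range 4, ‖iteratedFDeriv ℝ k f (x : Space d)‖

/-- The translation `τ_x h = h(· + x)`. -/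
def translation (x : Space d) (h : Surface d) : Surface d where
  toFun := fun y => h (y + x)
  contDiff' := h.contDiff.comp (contDiff_id.add contDiff_const)

theorem continuous_jet (k : Fin 4) : Continuous (Surface.jet (d := d) k) :=
  continuous_iff_le_induced.2 (iInf_le _ k)

theorem continuous_translation (x : Space d) : Continuous (translation (d := d) x) := by
  refine continuous_iInf_rng.2 fun k => continuous_induced_rng.2 ?_
  have key : (Surface.jet (d := d) k) ∘ translation x
      = fun h => (Surface.jet k h).comp ⟨fun y => y + x, by fun_prop⟩ := by
    funext h
    ext1 y
    exact iteratedFDeriv_comp_add_right (𝕜 := ℝ) (f := fun z => h z) (k : ℕ) x y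
  rw [key]
  exact (ContinuousMap.continuous_precomp _).comp (continuous_jet k)

/-! ## Standing assumptions on the law of the random field -/

/-- The assumptions on the law `P` of the random surface: a Borel probability measure on `Ω` that
is stationary, ergodic and stochastically continuous, with slopes and second derivatives bounded
by one deterministic constant. -/
class AdmissibleLaw (P : Measure (Surface d)) : Prop extends IsProbabilityMeasure P where
  /-- `P (τ_x⁻¹ B) = P B` for Borel sets `B`. -/
  stationary : ∀ (x : Space d) (B : Set (Surface d)), MeasurableSet B →
    P (translation x ⁻¹' B) = P B
  /-- Translation invariant Borel sets have probability `0` or `1`. -/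
  ergodic : ∀ B : Set (Surface d), MeasurableSet B → (∀ x : Space d, translation x '' B = B) →
    P B = 0 ∨ P B = 1
  /-- `τ_x h → h` in `P`-probability as `x → 0`, in the Fréchet topology of `Ω`. -/
  stochasticallyContinuous : ∀ (N : ℕ) (δ : ℝ), 0 < δ →
    Tendsto (fun x : Space d =>
      P {h : Surface d | δ < frechetSeminorm N (fun y => translation x h y - h y)})
      (𝓝 0) (𝓝 0)
  /-- `|∇h(x)| + |∇∇h(x)| ≤ K` for all `x`, almost surely. -/
  boundedDerivatives : ∃ K : ℝ, 0 < K ∧ ∀ᵐ h : Surface d ∂P, ∀ x : Space d,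
    ‖gradient (fun y => h y) x‖ + ‖iteratedFDeriv ℝ 2 (fun y => h y) x‖ ≤ K

/-! ## Metric tensor, surface element, drift -/

/-- The matrix `I + p ⊗ p`. -/
def slopeMetric (p : Space d) : Matrix (Fin d) (Fin d) ℝ :=
  1 + Matrix.vecMulVec (fun i => p i) (fun i => p i)

/-- The metric tensor `g(x, h) = I + ∇h(x) ⊗ ∇h(x)`. -/
def metricTensor (h : Surface d) (x : Space d) : Matrix (Fin d) (Fin d) ℝ :=
  slopeMetric (gradient (fun y => h y) x)

/-- The surface element `√|g|(x, h)`, `|g|` being the determinant of `g`. -/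
def surfaceElement (h : Surface d) (x : Space d) : ℝ :=
  Real.sqrt (metricTensor h x).det

/-- The matrix `√|g| g⁻¹` at `(x, h)`. -/
def coefficient (h : Surface d) (x : Space d) : Matrix (Fin d) (Fin d) ℝ :=
  surfaceElement h x • (metricTensor h x)⁻¹

/-- The random variable `F^e(h) = F(0, h) · e`, where `F = |g|^{-1/2} ∇·(√|g| g⁻¹)` is the
drift: `F_j = |g|^{-1/2} ∑_i ∂_i (√|g| g⁻¹)_{ij}`. -/
def drift (e : Space d) (h : Surface d) : ℝ :=
  ∑ j, ((surfaceElement h 0)⁻¹ *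
    ∑ i, fderiv ℝ (fun x => coefficient h x i j) 0 (basisVec i)) * e j

/-- The mean surface area `Z = ∫ √|g|(h) P(dh)`. -/
def meanArea (P : Measure (Surface d)) : ℝ := ∫ h, surfaceElement h 0 ∂P

/-- The probability measure `π(dh) = Z⁻¹ √|g|(h) P(dh)`. -/
def invariantLaw (P : Measure (Surface d)) : Measure (Surface d) :=
  P.withDensity fun h => ENNReal.ofReal (surfaceElement h 0 / meanArea P)

/-! ## Differentiation along translations in `L²(P)` -/

/-- `L²(P)`. The slopes being bounded, `L²(π)` is the same space of functions with an equivalent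
norm. -/
abbrev L2 (P : Measure (Surface d)) : Type := Lp ℝ 2 P

/-- `(L²(P))^d` with the inner product `⟨U, V⟩ = ∑_i ⟨U_i, V_i⟩`. -/
abbrev VecL2 (P : Measure (Surface d)) : Type := PiLp 2 fun _ : Fin d => L2 P

variable (P : Measure (Surface d)) [AdmissibleLaw P]

theorem measurePreserving_translation (x : Space d) : MeasurePreserving (translation x) P P where
  measurable := (continuous_translation x).measurable
  map_eq := by
    ext B hB
    rw [Measure.map_apply (continuous_translation x).measurable hB]
    exact AdmissibleLaw.stationary x B hB

/-- `V ↦ V ∘ τ_x` on `L²(P)`. -/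
def shift (x : Space d) : L2 P →ₗᵢ[ℝ] L2 P :=
  Lp.compMeasurePreservingₗᵢ ℝ (translation x) (measurePreserving_translation P x)

/-- `D_i V = d/dt V(τ_{t e_i} h)` at `t = 0`, in the sense of `L²(P)`; used only on its domain. -/
def partialD (i : Fin d) (V : L2 P) : L2 P := deriv (fun t : ℝ => shift P (t • basisVec i) V) 0

/-- `H¹`: the intersection of the domains of the operators `D_i`. -/
def sobolevH1 : Submodule ℝ (L2 P) where
  carrier := {V | ∀ i : Fin d, DifferentiableAt ℝ (fun t : ℝ => shift P (t • basisVec i) V) 0}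
  add_mem' := by
    intro V W hV hW i
    simpa only [map_add] using (hV i).fun_add (hW i)
  zero_mem' := by
    intro i
    simp
  smul_mem' := by
    intro c V hV i
    simpa only [map_smul] using (hV i).fun_const_smul c

/-- The gradient `𝔻 V = (D_i V)_i` for `V ∈ H¹`. -/
def gradH1 : sobolevH1 P →ₗ[ℝ] VecL2 P where
  toFun V := WithLp.toLp 2 fun i => partialD P i (V : L2 P)
  map_add' := by
    intro V W
    ext1 i
    simp only [partialD, Submodule.coe_add, map_add, PiLp.add_apply]
    exact deriv_fun_add (V.2 i) (W.2 i)
  map_smul' := by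
    intro c V
    ext1 i
    simp only [partialD, Submodule.coe_smul, map_smul, PiLp.smul_apply, RingHom.id_apply]
    exact deriv_fun_const_smul c (V.2 i)

/-! ## Dirichlet form and generator -/

/-- The Dirichlet form `Z⁻¹ ∫ 𝔻u · g⁻¹ 𝔻v √|g| dP`, for `u, v ∈ H¹`. -/
def dirichletForm (u v : sobolevH1 P) : ℝ :=
  (meanArea P)⁻¹ * ∫ h, (fun i => gradH1 P u i h) ⬝ᵥ
    (coefficient h 0 *ᵥ fun j => gradH1 P v j h) ∂P

/-- `u` is in the domain of the generator `𝓛` and `𝓛 u = w`, where `𝓛` is the self-adjoint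
operator on `L²(π)` of the Dirichlet form, an extension of
`f ↦ |g|^{-1/2} 𝔻·(√|g| g⁻¹ 𝔻f)`:
`⟨-𝓛 u, φ⟩_{L²(π)} = Z⁻¹ ∫ 𝔻u · g⁻¹ 𝔻φ √|g| dP` for all `φ ∈ H¹`. -/
def IsGenerator (u : sobolevH1 P) (w : L2 P) : Prop :=
  ∀ φ : sobolevH1 P, ∫ h, -(w h) * (φ : L2 P) h ∂(invariantLaw P) = dirichletForm P u φ

/-! ### The Dirichlet form is a semi-inner product on `H¹` -/

theorem slopeMetric_posDef (p : Space d) : (slopeMetric p).PosDef :=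
  Matrix.PosDef.one.add_posSemidef (by
    simpa using Matrix.posSemidef_vecMulVec_self_star (R := ℝ) (fun i => p i))

theorem coefficient_posSemidef (h : Surface d) (x : Space d) :
    (coefficient h x).PosSemidef :=
  (slopeMetric_posDef _).inv.posSemidef.smul (Real.sqrt_nonneg _)

theorem one_le_det_slopeMetric (p : Space d) : 1 ≤ (slopeMetric p).det := by
  have : (slopeMetric p).det = 1 + (fun i => p i) ⬝ᵥ (fun i => p i) := by
    unfold slopeMetric
    rw [Matrix.vecMulVec_eq Unit, Matrix.det_one_add_replicateCol_mul_replicateRow]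
  rw [this]
  have := Finset.sum_nonneg (s := Finset.univ) fun i _ => mul_self_nonneg (p i)
  simpa [dotProduct] using this

/-- Ellipticity: `|v|² ≤ (2 + |p|²) v·√|g| g⁻¹ v`. -/
theorem slopeMetric_elliptic (p : Space d) (v : Fin d → ℝ) :
    v ⬝ᵥ v ≤ (2 + ‖p‖ ^ 2) *
      (v ⬝ᵥ ((Real.sqrt (slopeMetric p).det • (slopeMetric p)⁻¹) *ᵥ v)) := by
  set q : Fin d → ℝ := fun i => p i with hq
  set w := (slopeMetric p)⁻¹ *ᵥ v with hw
  have hv : v = w + (q ⬝ᵥ w) • q := by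
    have h1 : slopeMetric p *ᵥ w = v := by
      rw [hw, Matrix.mulVec_mulVec, Matrix.mul_nonsing_inv _
        (isUnit_iff_ne_zero.2 (slopeMetric_posDef p).det_pos.ne'), Matrix.one_mulVec]
    rw [← h1]
    simp [slopeMetric, Matrix.add_mulVec, Matrix.vecMulVec_mulVec, hq]
  have hqq : q ⬝ᵥ q = ‖p‖ ^ 2 := by
    rw [EuclideanSpace.real_norm_sq_eq]
    simp [dotProduct, hq, sq]
  have hww : 0 ≤ w ⬝ᵥ w := by simpa using dotProduct_star_self_nonneg w
  have hs : 1 ≤ Real.sqrt (slopeMetric p).det := Real.one_le_sqrt.2 (one_le_det_slopeMetric p)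
  have e1 : v ⬝ᵥ w = w ⬝ᵥ w + (q ⬝ᵥ w) ^ 2 := by
    rw [hv]
    simp only [add_dotProduct, smul_dotProduct, smul_eq_mul]
    ring
  have e2 : v ⬝ᵥ v = w ⬝ᵥ w + 2 * (q ⬝ᵥ w) ^ 2 + ‖p‖ ^ 2 * (q ⬝ᵥ w) ^ 2 := by
    rw [hv]
    simp only [add_dotProduct, smul_dotProduct, smul_eq_mul, dotProduct_add, dotProduct_smul, hqq,
      dotProduct_comm w q]
    ring
  rw [Matrix.smul_mulVec, dotProduct_smul, smul_eq_mul, ← hw, e2]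
  have h0 : 0 ≤ v ⬝ᵥ w := by rw [e1]; positivity
  have h3 : v ⬝ᵥ w ≤ Real.sqrt (slopeMetric p).det * (v ⬝ᵥ w) := le_mul_of_one_le_left h0 hs
  have h4 : (2 + ‖p‖ ^ 2) * (v ⬝ᵥ w) ≤ (2 + ‖p‖ ^ 2) *
    (Real.sqrt (slopeMetric p).det * (v ⬝ᵥ w)) := mul_le_mul_of_nonneg_left h3 (by positivity)
  refine le_trans ?_ h4
  rw [e1]
  nlinarith [mul_nonneg (sq_nonneg ‖p‖) hww]

theorem continuous_slopeCoefficient (i j : Fin d) :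
    Continuous fun p : Space d => (Real.sqrt (slopeMetric p).det • (slopeMetric p)⁻¹) i j := by
  have hg : Continuous (slopeMetric (d := d)) := by
    unfold slopeMetric
    refine continuous_const.add (continuous_matrix fun i j => ?_)
    simp only [Matrix.vecMulVec_apply]
    fun_prop
  have hinv : Continuous fun p : Space d => (slopeMetric p)⁻¹ := by
    simp only [Matrix.inv_def, Ring.inverse_eq_inv']
    exact (hg.matrix_det.inv₀ fun p => (slopeMetric_posDef p).det_pos.ne').smul hg.matrix_adjugate
  exact ((hg.matrix_det.sqrt).smul hinv).matrix_elem i j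

theorem continuous_slope : Continuous fun h : Surface d => gradient (fun y => h y) 0 := by
  have h1 : Continuous fun h : Surface d => Surface.jet 1 h 0 :=
    (continuous_eval_const (0 : Space d)).comp (continuous_jet 1)
  have h2 : ∀ h : Surface d, gradient (fun y => h y) 0 = (InnerProductSpace.toDual ℝ (Space d)).symm
      ((continuousMultilinearCurryFin1 ℝ (Space d) ℝ) (Surface.jet 1 h 0)) := by
    intro h
    unfold gradient
    congr 1
    ext v
    exact (iteratedFDeriv_one_apply (𝕜 := ℝ) (f := fun y => h y) (x := 0) (fun _ => v)).symm
  simp only [h2]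
  exact (LinearIsometryEquiv.continuous _).comp ((LinearIsometryEquiv.continuous _).comp h1)

theorem integrable_dirichlet (U V : VecL2 P) :
    Integrable (fun h => (fun i => U i h) ⬝ᵥ (coefficient h 0 *ᵥ fun j => V j h)) P := by
  simp only [dotProduct, Matrix.mulVec]
  refine integrable_finsetSum _ fun i _ => ?_
  simp only [Finset.mul_sum]
  refine integrable_finsetSum _ fun j _ => ?_
  obtain ⟨K, -, hK⟩ := AdmissibleLaw.boundedDerivatives (P := P)
  obtain ⟨C, hC⟩ := (isCompact_closedBall (0 : Space d) K).exists_bound_of_continuousOn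
    (continuous_slopeCoefficient i j).continuousOn
  have hUV : Integrable (fun h => U i h * V j h) P :=
    (Lp.memLp (U i)).integrable_mul (Lp.memLp (V j))
  have hm : AEStronglyMeasurable (fun h : Surface d => coefficient h 0 i j) P :=
    ((continuous_slopeCoefficient i j).comp continuous_slope).measurable.aestronglyMeasurable
  refine (hUV.bdd_mul (c := C) hm ?_).congr (ae_of_all _ fun h => by ring)
  filter_upwards [hK] with h hh
  refine hC _ ?_
  rw [mem_closedBall_zero_iff]
  exact le_trans (le_add_of_nonneg_right (norm_nonneg _)) (hh 0)

theorem dirichletForm_comm (u v : sobolevH1 P) : dirichletForm P u v = dirichletForm P v u := by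
  simp only [dirichletForm]
  congr 1
  refine integral_congr_ae (ae_of_all _ fun h => ?_)
  have hs : (coefficient h 0)ᵀ = coefficient h 0 := by
    simpa [Matrix.IsHermitian] using (coefficient_posSemidef h 0).1
  dsimp only
  rw [Matrix.dotProduct_mulVec, ← Matrix.mulVec_transpose, hs, dotProduct_comm]

theorem dirichletForm_self_nonneg (u : sobolevH1 P) : 0 ≤ dirichletForm P u u := by
  refine mul_nonneg (inv_nonneg.2 (integral_nonneg fun _ => Real.sqrt_nonneg _))
    (integral_nonneg fun h => ?_)
  simpa using (coefficient_posSemidef h 0).dotProduct_mulVec_nonneg (fun i => gradH1 P u i h)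

theorem dirichletForm_add_left (u v w : sobolevH1 P) :
    dirichletForm P (u + v) w = dirichletForm P u w + dirichletForm P v w := by
  simp only [dirichletForm]
  rw [← mul_add, ← integral_add (integrable_dirichlet P _ _) (integrable_dirichlet P _ _)]
  congr 1
  refine integral_congr_ae ?_
  have hadd : ∀ᵐ h ∂P, ∀ i, gradH1 P (u + v) i h = gradH1 P u i h + gradH1 P v i h := by
    rw [ae_all_iff]
    intro i
    rw [map_add, PiLp.add_apply]
    exact Lp.coeFn_add _ _
  filter_upwards [hadd] with h hh
  simp only [hh]
  exact add_dotProduct (fun i => gradH1 P u i h) (fun i => gradH1 P v i h) _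

theorem dirichletForm_smul_left (r : ℝ) (u w : sobolevH1 P) :
    dirichletForm P (r • u) w = r * dirichletForm P u w := by
  simp only [dirichletForm]
  rw [mul_left_comm, ← integral_const_mul r]
  congr 1
  refine integral_congr_ae ?_
  have hsmul : ∀ᵐ h ∂P, ∀ i, gradH1 P (r • u) i h = r * gradH1 P u i h := by
    rw [ae_all_iff]
    intro i
    rw [map_smul, PiLp.smul_apply]
    exact Lp.coeFn_smul _ _
  filter_upwards [hsmul] with h hh
  simp only [hh]
  exact smul_dotProduct r (fun i => gradH1 P u i h) _

/-- `H¹` as the carrier of the Dirichlet seminorm (a copy of `sobolevH1 P`, to carry another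
norm). -/
def PreHOne : Type := sobolevH1 P

instance : AddCommGroup (PreHOne P) := inferInstanceAs (AddCommGroup (sobolevH1 P))

instance : Module ℝ (PreHOne P) := inferInstanceAs (Module ℝ (sobolevH1 P))

/-- The identity, from the copy `PreHOne P` to `sobolevH1 P`. -/
def PreHOne.toH1 : PreHOne P →ₗ[ℝ] sobolevH1 P where
  toFun u := u
  map_add' _ _ := rfl
  map_smul' _ _ := rfl

/-- The semi-inner product `⟨u, v⟩_1 = ⟨-𝓛u, v⟩_{L²(π)}`, as given by the Dirichlet form. -/
@[reducible]
def dirichletCore : PreInnerProductSpace.Core ℝ (PreHOne P) where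
  inner u v := dirichletForm P (PreHOne.toH1 P u) (PreHOne.toH1 P v)
  conj_inner_symm u v := dirichletForm_comm P _ _
  re_inner_nonneg u := dirichletForm_self_nonneg P _
  add_left u v w := by
    rw [map_add]
    exact dirichletForm_add_left P _ _ _
  smul_left u w r := by
    rw [map_smul]
    exact dirichletForm_smul_left P r _ _

instance : SeminormedAddCommGroup (PreHOne P) :=
  @InnerProductSpace.Core.toSeminormedAddCommGroup ℝ (PreHOne P) _ _ _ (dirichletCore P)

instance : InnerProductSpace ℝ (PreHOne P) := InnerProductSpace.ofCore (dirichletCore P)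

theorem norm_sq_eq_dirichlet (u : PreHOne P) :
    ‖u‖ ^ 2 = dirichletForm P (PreHOne.toH1 P u) (PreHOne.toH1 P u) := by
  rw [← real_inner_self_eq_norm_sq]
  rfl

theorem meanArea_pos : 0 < meanArea P := by
  have hi : Integrable (fun h : Surface d => surfaceElement h 0) P := by
    obtain ⟨K, -, hK⟩ := AdmissibleLaw.boundedDerivatives (P := P)
    have hg : Continuous fun p : Space d => Real.sqrt (slopeMetric p).det := by
      refine (Continuous.matrix_det ?_).sqrt
      unfold slopeMetric
      refine continuous_const.add (continuous_matrix fun i j => ?_)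
      simp only [Matrix.vecMulVec_apply]
      fun_prop
    obtain ⟨C, hC⟩ := (isCompact_closedBall (0 : Space d) K).exists_bound_of_continuousOn
      hg.continuousOn
    refine Integrable.of_bound (hg.comp continuous_slope).measurable.aestronglyMeasurable C ?_
    filter_upwards [hK] with h hh
    refine hC _ ?_
    rw [mem_closedBall_zero_iff]
    exact le_trans (le_add_of_nonneg_right (norm_nonneg _)) (hh 0)
  have : (1 : ℝ) ≤ meanArea P := by
    have := integral_mono (μ := P) (integrable_const (1 : ℝ)) hi
      (fun h => Real.one_le_sqrt.2 (one_le_det_slopeMetric _))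
    simpa [meanArea] using this
  linarith

theorem exists_gradH1_bound : ∃ C : ℝ, ∀ u : PreHOne P,
    ‖gradH1 P (PreHOne.toH1 P u)‖ ≤ C * ‖u‖ := by
  obtain ⟨K, hK0, hK⟩ := AdmissibleLaw.boundedDerivatives (P := P)
  have hZ := meanArea_pos P
  refine ⟨Real.sqrt ((2 + K ^ 2) * meanArea P), fun u => ?_⟩
  set U := gradH1 P (PreHOne.toH1 P u) with hU
  have hsq : ‖U‖ ^ 2 = ∫ h, (fun i => U i h) ⬝ᵥ (fun i => U i h) ∂P := by
    rw [PiLp.norm_sq_eq_of_L2]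
    simp only [dotProduct]
    rw [integral_finsetSum (f := fun i h => U i h * U i h) _
      fun i _ => (Lp.memLp (U i)).integrable_mul (Lp.memLp (U i))]
    refine Finset.sum_congr rfl fun i _ => ?_
    rw [← real_inner_self_eq_norm_sq, L2.inner_def]
    simp [sq]
  have hle : ‖U‖ ^ 2 ≤ (2 + K ^ 2) * meanArea P * ‖u‖ ^ 2 := by
    rw [norm_sq_eq_dirichlet, dirichletForm, hsq, mul_assoc, mul_inv_cancel_left₀ hZ.ne',
      ← integral_const_mul]
    refine integral_mono_of_nonneg (ae_of_all _ fun h => ?_)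
      ((integrable_dirichlet P U U).const_mul _) ?_
    · exact Finset.sum_nonneg fun i _ => mul_self_nonneg _
    · filter_upwards [hK] with h hh
      refine (slopeMetric_elliptic (gradient (fun y => h y) 0) _).trans ?_
      have h1 : ‖gradient (fun y => h y) (0 : Space d)‖ ≤ K :=
        le_trans (le_add_of_nonneg_right (norm_nonneg _)) (hh 0)
      refine mul_le_mul_of_nonneg_right (by gcongr) ?_
      have h2 := (coefficient_posSemidef h 0).dotProduct_mulVec_nonneg (fun i => U i h)
      rw [star_trivial] at h2
      exact h2
  calc ‖U‖ = Real.sqrt (‖U‖ ^ 2) := (Real.sqrt_sq (norm_nonneg _)).symm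
    _ ≤ Real.sqrt ((2 + K ^ 2) * meanArea P * ‖u‖ ^ 2) := Real.sqrt_le_sqrt hle
    _ = _ := by rw [Real.sqrt_mul (by positivity), Real.sqrt_sq (norm_nonneg _)]

/-- The Hilbert space `𝓗₁`: the (Hausdorff) completion for the seminorm
`‖φ‖₁² = ⟨-𝓛φ, φ⟩_{L²(π)}`. Constants have seminorm zero, so that no centring of `φ` is
needed. -/
abbrev HOne : Type := UniformSpace.Completion (PreHOne P)

/-- The gradient `𝔻 : 𝓗₁ → (L²(P))^d`: the continuous extension of the gradient on `H¹`,
which is bounded for the seminorm of `𝓗₁` (`exists_gradH1_bound`). -/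
def gradHOne : HOne P → VecL2 P :=
  UniformSpace.Completion.extension fun u : PreHOne P => gradH1 P (PreHOne.toH1 P u)

theorem gradHOne_coe (u : PreHOne P) :
    gradHOne P (u : HOne P) = gradH1 P (PreHOne.toH1 P u) := by
  obtain ⟨C, hC⟩ := exists_gradH1_bound P
  exact UniformSpace.Completion.extension_coe
    (AddMonoidHomClass.uniformContinuous_of_bound
      ((gradH1 P).comp (PreHOne.toH1 P)) C hC) u

/-! ## The corrector -/

/-- `u` is the `λ`-corrector: `(λ - 𝓛) u = F^e`. -/
def IsResolventCorrector (e : Space d) (lam : ℝ) (u : PreHOne P) : Prop :=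
  ∃ w : L2 P, IsGenerator P (PreHOne.toH1 P u) w ∧
    ∀ᵐ h ∂P, lam * (PreHOne.toH1 P u : L2 P) h - w h = drift e h

/-- `χ ∈ 𝓗₁` is the corrector `χ^e`: the limit in `𝓗₁`, as `λ ↓ 0`, of the `λ`-correctors. -/
def IsCorrector (e : Space d) (χ : HOne P) : Prop :=
  ∃ u : ℝ → PreHOne P, (∀ lam : ℝ, 0 < lam → IsResolventCorrector P e lam (u lam)) ∧
    Tendsto (fun lam => (u lam : HOne P)) (𝓝[>] 0) (𝓝 χ)

/-! ## Potential, constant and divergence-free fields; the cell problem -/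

/-- `L²_pot(P)`: the closure in `(L²(P))^d` of the range of `𝔻`. -/
def L2pot : Submodule ℝ (VecL2 P) := (LinearMap.range (gradH1 P)).topologicalClosure

/-- The constant vector field with value `c`. -/
def constField (c : Space d) : VecL2 P := WithLp.toLp 2 fun i => Lp.const 2 P (c i)

/-- `L²_c(P)`: the constant vector fields. -/
def L2const : Submodule ℝ (VecL2 P) :=
  Submodule.span ℝ (Set.range fun i : Fin d => constField P (basisVec i))

/-- `L²_div(P)`: the orthogonal complement of `L²_c(P) ⊕ L²_pot(P)` in `(L²(P))^d`. -/
def L2div : Submodule ℝ (VecL2 P) := (L2const P ⊔ L2pot P)ᗮ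

/-- The weak cell problem: `V ∈ L²_pot(P)`, and `√|g| g⁻¹ (e + V)` lies in
`L²_div(P) ⊕ L²_c(P)`, the space of divergence-free fields. -/
def IsCellSolution (e : Space d) (V : VecL2 P) : Prop :=
  V ∈ L2pot P ∧ ∃ W ∈ L2div P ⊔ L2const P, ∀ i : Fin d, ∀ᵐ h ∂P,
    W i h = (coefficient h 0 *ᵥ fun j => e j + V j h) i

end RandomSurface

end

open RandomSurface

/-! The drift is a divergence: stationarity gives the integration by parts
`Z ⟨F^e, φ⟩_{L²(π)} = -⟨√|g| g⁻¹ e, 𝔻 φ⟩` (`inner_areaOp_driftL2`), for which the entries of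
`√|g| g⁻¹` have to be differentiable in `L²(P)` along translations
(`hasDerivAt_shift_coefficientL2`; this uses the bounds on `∇h` and `∇∇h` on all of `ℝ^d`). Hence
`F^e` is a bounded functional on `𝓗₁`, and the Riesz representation theorem gives `χ ∈ 𝓗₁` with
`⟨χ, φ⟩₁ = ⟨F^e, φ⟩_{L²(π)}` for `φ ∈ H¹` (`exists_weakCorrector`).

The operators `D_i` are closed, being generators of groups of isometries, so that `H¹` with its graph
norm is a Hilbert space and the `λ`-correctors exist by the Lax–Milgram lemma
(`exists_isResolventCorrector`). They solve `λ ⟨u_λ, φ⟩_{L²(π)} + ⟨u_λ - χ, φ⟩₁ = 0`; testing with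
`u_λ - φ`, where `φ ∈ H¹` is close to `χ` in `𝓗₁`, gives `‖u_λ - χ‖₁ → 0`
(`tendsto_of_regularization`). Thus `χ` is the only corrector (`isCorrector_iff`).

Gradients have mean zero, so `L²_pot` is orthogonal to `L²_c`, and `L²_div ⊕ L²_c` is the orthogonal
complement of `L²_pot` (`L2div_sup_L2const`). The cell problem for `V ∈ L²_pot` therefore says
`⟨√|g| g⁻¹ (e + V), 𝔻 φ⟩ = 0` for all `φ ∈ H¹`, which for `V = 𝔻 χ` is the equation of `χ`; its
solution is unique by ellipticity of `√|g| g⁻¹`. -/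

open MeasureTheory Filter Topology
open scoped Matrix

noncomputable section

namespace RandomSurface

variable {d : ℕ}

/-! ### Orbits of one-parameter groups of isometries -/

/-- The infinitesimal generator of a one-parameter group of isometries is closed: the derivatives
`t ↦ U t (w n)` of the orbits of `u n` converge uniformly in `t`. -/
theorem hasDerivAt_orbit_of_tendsto {X : Type*} [NormedAddCommGroup X] [NormedSpace ℝ X]
    (U : ℝ → X →ₗᵢ[ℝ] X) (h0 : ∀ v, U 0 v = v) (hadd : ∀ s t v, U (s + t) v = U s (U t v))
    {u w : ℕ → X} {v z : X} (hd : ∀ n, HasDerivAt (fun t => U t (u n)) (w n) 0)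
    (hu : Tendsto u atTop (𝓝 v)) (hw : Tendsto w atTop (𝓝 z)) :
    HasDerivAt (fun t => U t v) z 0 := by
  have key : ∀ x, HasDerivAt (fun t => U t v) (U x z) x := by
    refine hasDerivAt_of_tendstoUniformly (l := atTop) (f := fun n t => U t (u n))
      (f' := fun n t => U t (w n)) ?_ ?_ ?_
    · rw [Metric.tendstoUniformly_iff]
      intro ε hε
      filter_upwards [(Metric.tendsto_nhds.1 hw) ε hε] with n hn x
      rwa [(U x).dist_map, dist_comm]
    · refine Eventually.of_forall fun n x => ?_
      have h1 : HasDerivAt (fun t => U (t - x) (u n)) (w n) x := by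
        have := hd n
        rw [← sub_self x] at this
        simpa using this.comp_sub_const x x
      have h2 := (U x).toContinuousLinearMap.hasFDerivAt.comp_hasDerivAt x h1
      refine h2.congr_of_eventuallyEq (Eventually.of_forall fun t => ?_)
      simp [← hadd]
    · intro x
      exact ((U x).continuous.tendsto v).comp hu
  simpa [h0] using key 0

/-! ### The translation group on `L²(P)` -/

theorem translation_zero (h : Surface d) : translation 0 h = h := by
  cases h; simp [translation]

theorem translation_comp (x y : Space d) (h : Surface d) :
    translation y (translation x h) = translation (x + y) h := by
  simp only [translation, Surface.mk.injEq]
  funext z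
  rw [add_assoc, add_comm y x]

section Shift

variable (P : Measure (Surface d)) [AdmissibleLaw P]

theorem coeFn_shift (x : Space d) (V : L2 P) : shift P x V =ᵐ[P] fun h => V (translation x h) :=
  Lp.coeFn_compMeasurePreserving V (measurePreserving_translation P x)

theorem shift_zero (V : L2 P) : shift P 0 V = V := by
  ext1
  filter_upwards [coeFn_shift P 0 V] with h hh
  rw [hh, translation_zero]

theorem shift_add (x y : Space d) (V : L2 P) : shift P (x + y) V = shift P x (shift P y V) := by
  ext1
  have h1 := (measurePreserving_translation P x).quasiMeasurePreserving.ae (coeFn_shift P y V)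
  filter_upwards [coeFn_shift P (x + y) V, coeFn_shift P x (shift P y V), h1] with h e1 e2 e3
  rw [e1, e2, e3, translation_comp]

theorem mem_sobolevH1_of_hasDerivAt {V : L2 P} {w : Fin d → L2 P}
    (h : ∀ i, HasDerivAt (fun t : ℝ => shift P (t • basisVec i) V) (w i) 0) :
    V ∈ sobolevH1 P :=
  fun i => (h i).differentiableAt

theorem hasDerivAt_shift (u : sobolevH1 P) (i : Fin d) :
    HasDerivAt (fun t : ℝ => shift P (t • basisVec i) (u : L2 P)) (gradH1 P u i) 0 :=
  (u.2 i).hasDerivAt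

/-- The operators `D_i` are closed. -/
theorem hasDerivAt_shift_of_tendsto (i : Fin d) {u w : ℕ → L2 P} {v z : L2 P}
    (hd : ∀ n, HasDerivAt (fun t : ℝ => shift P (t • basisVec i) (u n)) (w n) 0)
    (hu : Tendsto u atTop (𝓝 v)) (hw : Tendsto w atTop (𝓝 z)) :
    HasDerivAt (fun t : ℝ => shift P (t • basisVec i) v) z 0 := by
  refine hasDerivAt_orbit_of_tendsto (fun t : ℝ => shift P (t • basisVec i)) ?_ ?_ hd hu hw
  · intro v
    rw [zero_smul, shift_zero]
  · intro s t v
    rw [add_smul, shift_add]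

/-- Integration by parts on `Ω`: by stationarity `⟨V ∘ τ_x, W ∘ τ_x⟩ = ⟨V, W⟩`, and this identity is
differentiated at `x = 0`. -/
theorem inner_deriv_shift {i : Fin d} {V W V' W' : L2 P}
    (hV : HasDerivAt (fun t : ℝ => shift P (t • basisVec i) V) V' 0)
    (hW : HasDerivAt (fun t : ℝ => shift P (t • basisVec i) W) W' 0) :
    inner ℝ V W' = -inner ℝ V' W := by
  have h1 := hV.inner ℝ hW
  have h2 : (fun t : ℝ => inner ℝ (shift P (t • basisVec i) V) (shift P (t • basisVec i) W))
      = fun _ => inner ℝ V W := by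
    funext t
    exact (shift P _).inner_map_map V W
  rw [h2] at h1
  have h3 := h1.unique (hasDerivAt_const (0 : ℝ) (inner ℝ V W))
  simp only [zero_smul, shift_zero] at h3
  linarith

theorem shift_const (x : Space d) (c : ℝ) : shift P x (Lp.const 2 P c) = Lp.const 2 P c := by
  ext1
  have h1 := (measurePreserving_translation P x).quasiMeasurePreserving.ae
    (Lp.coeFn_const 2 P c)
  filter_upwards [coeFn_shift P x (Lp.const 2 P c), Lp.coeFn_const 2 P c, h1] with h e1 e2 e3
  rw [e1, e2, e3]
  rfl

/-- Gradients have mean zero. -/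
theorem inner_const_gradH1 (u : sobolevH1 P) (i : Fin d) (c : ℝ) :
    inner ℝ (Lp.const 2 P c) (gradH1 P u i) = 0 := by
  have hc : HasDerivAt (fun t : ℝ => shift P (t • basisVec i) (Lp.const 2 P c)) 0 0 := by
    simpa only [shift_const] using hasDerivAt_const (0 : ℝ) (Lp.const 2 P c)
  simpa using inner_deriv_shift P hc (hasDerivAt_shift P u i)

/-- The graph of the gradient, `{(u, 𝔻 u) : u ∈ H¹}`, in `L²(P) × (L²(P))^d`: this is `H¹` with
its Hilbert space structure. -/
def sobolevGraph : Submodule ℝ (WithLp 2 (L2 P × VecL2 P)) :=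
  LinearMap.range (((WithLp.linearEquiv 2 ℝ (L2 P × VecL2 P)).symm : _ →ₗ[ℝ] _) ∘ₗ
    ((sobolevH1 P).subtype.prod (gradH1 P)))

theorem mem_sobolevGraph {x : WithLp 2 (L2 P × VecL2 P)} :
    x ∈ sobolevGraph P ↔ ∃ u : sobolevH1 P, (u : L2 P) = x.fst ∧ gradH1 P u = x.snd := by
  constructor
  · rintro ⟨u, rfl⟩
    exact ⟨u, rfl, rfl⟩
  · rintro ⟨u, h1, h2⟩
    refine ⟨u, ?_⟩
    apply WithLp.ofLp_injective
    exact Prod.ext h1 h2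

theorem isClosed_sobolevGraph : IsClosed (sobolevGraph P : Set (WithLp 2 (L2 P × VecL2 P))) := by
  refine IsSeqClosed.isClosed fun x y hx hxy => ?_
  simp only [SetLike.mem_coe, mem_sobolevGraph] at hx ⊢
  choose u hu1 hu2 using hx
  have h1 : Tendsto (fun n => (u n : L2 P)) atTop (𝓝 y.fst) := by
    simp only [hu1]
    exact ((WithLp.fstL 2 ℝ (L2 P) (VecL2 P)).continuous.tendsto y).comp hxy
  have h2 : ∀ i, Tendsto (fun n => gradH1 P (u n) i) atTop (𝓝 (y.snd i)) := by
    intro i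
    simp only [hu2]
    exact (((PiLp.proj 2 (fun _ : Fin d => L2 P) i).comp
      (WithLp.sndL 2 ℝ (L2 P) (VecL2 P))).continuous.tendsto y).comp hxy
  have hd : ∀ i, HasDerivAt (fun t : ℝ => shift P (t • basisVec i) y.fst) (y.snd i) 0 :=
    fun i => hasDerivAt_shift_of_tendsto P i (fun n => hasDerivAt_shift P (u n) i) h1 (h2 i)
  refine ⟨⟨y.fst, mem_sobolevH1_of_hasDerivAt P hd⟩, rfl, ?_⟩
  ext1 i
  exact (hd i).deriv

instance : CompleteSpace (sobolevGraph P) :=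
  (isClosed_sobolevGraph P).completeSpace_coe

end Shift

/-! ### Regularity of the coefficient field -/

theorem det_slopeMetric (p : Space d) : (slopeMetric p).det = 1 + ‖p‖ ^ 2 := by
  unfold slopeMetric
  rw [Matrix.vecMulVec_eq Unit, Matrix.det_one_add_replicateCol_mul_replicateRow,
    EuclideanSpace.real_norm_sq_eq]
  simp [dotProduct, sq]

/-- The Sherman–Morrison formula for `(I + p ⊗ p)⁻¹`. -/
theorem inv_slopeMetric (p : Space d) : (slopeMetric p)⁻¹ =
    1 - (1 + ‖p‖ ^ 2)⁻¹ • Matrix.vecMulVec (fun i => p i) (fun i => p i) := by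
  have hp : (1 + ‖p‖ ^ 2) ≠ 0 := by positivity
  have hpp : (fun i => p i) ⬝ᵥ (fun i => p i) = ‖p‖ ^ 2 := by
    rw [EuclideanSpace.real_norm_sq_eq]
    simp [dotProduct, sq]
  refine Matrix.inv_eq_right_inv ?_
  have hsq : Matrix.vecMulVec (fun i => p i) (fun i => p i) *
      Matrix.vecMulVec (fun i => p i) (fun i => p i) =
      ‖p‖ ^ 2 • Matrix.vecMulVec (fun i => p i) (fun i => p i) := by
    rw [Matrix.vecMulVec_mul_vecMulVec, hpp, Matrix.vecMulVec_smul]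
  rw [slopeMetric, add_mul, mul_sub, mul_sub, mul_smul_comm, mul_smul_comm, hsq, one_mul, one_mul,
    mul_one]
  ext i j
  simp only [Matrix.add_apply, Matrix.sub_apply, Matrix.smul_apply, smul_eq_mul]
  field_simp
  ring

theorem contDiff_slopeCoefficient (i j : Fin d) : ContDiff ℝ 1
    fun p : Space d => (Real.sqrt (slopeMetric p).det • (slopeMetric p)⁻¹) i j := by
  have hp : ∀ p : Space d, (1 + ‖p‖ ^ 2) ≠ 0 := fun p => by positivity
  have hn : ContDiff ℝ 1 fun p : Space d => 1 + ‖p‖ ^ 2 := contDiff_const.add (contDiff_norm_sq ℝ)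
  simp only [det_slopeMetric, inv_slopeMetric, Matrix.smul_apply, Matrix.sub_apply,
    Matrix.vecMulVec_apply, smul_eq_mul]
  refine (hn.sqrt hp).mul (contDiff_const.sub ((hn.inv hp).mul (ContDiff.mul ?_ ?_)))
  · fun_prop
  · fun_prop

theorem contDiff_gradient (h : Surface d) : ContDiff ℝ 2 (gradient fun y => h y) := by
  have h1 : ContDiff ℝ 2 (fderiv ℝ fun y => h y) := h.contDiff.fderiv_right (by norm_num)
  exact (InnerProductSpace.toDual ℝ (Space d)).symm.toContinuousLinearEquiv.contDiff.comp h1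

theorem norm_fderiv_gradient (h : Surface d) (x : Space d) :
    ‖fderiv ℝ (gradient fun y => h y) x‖ = ‖iteratedFDeriv ℝ 2 (fun y => h y) x‖ := by
  have h1 : gradient (fun y => h y)
      = (InnerProductSpace.toDual ℝ (Space d)).symm ∘ (fderiv ℝ fun y => h y) := rfl
  rw [← norm_iteratedFDeriv_fderiv, norm_iteratedFDeriv_one, h1,
    LinearIsometryEquiv.comp_fderiv']
  exact LinearIsometry.norm_toContinuousLinearMap_comp
    (InnerProductSpace.toDual ℝ (Space d)).symm.toLinearIsometry

/-- A bound on `∇h` and `∇∇h` bounds the Lipschitz constant of `√|g| g⁻¹`. -/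
theorem exists_lipschitzWith_coefficient (K : ℝ) (i j : Fin d) : ∃ C : NNReal, ∀ h : Surface d,
    (∀ x, ‖gradient (fun y => h y) x‖ + ‖iteratedFDeriv ℝ 2 (fun y => h y) x‖ ≤ K) →
    LipschitzWith C fun x => coefficient h x i j := by
  have hc := contDiff_slopeCoefficient (d := d) i j
  obtain ⟨C, hC⟩ := (isCompact_closedBall (0 : Space d) K).exists_bound_of_continuousOn
    (hc.continuous_fderiv one_ne_zero).continuousOn
  refine ⟨C.toNNReal * K.toNNReal, fun h hK => ?_⟩
  have h1 : LipschitzOnWith C.toNNReal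
      (fun p : Space d => (Real.sqrt (slopeMetric p).det • (slopeMetric p)⁻¹) i j)
      (Metric.closedBall 0 K) := by
    refine (convex_closedBall (0 : Space d) K).lipschitzOnWith_of_nnnorm_fderiv_le (𝕜 := ℝ)
      (fun p _ => (hc.differentiable one_ne_zero).differentiableAt) fun p hp => ?_
    rw [← NNReal.coe_le_coe, coe_nnnorm]
    exact (hC p hp).trans (Real.le_coe_toNNReal C)
  have h2 : LipschitzWith K.toNNReal (gradient fun y => h y) := by
    refine lipschitzWith_of_nnnorm_fderiv_le (𝕜 := ℝ)
      ((contDiff_gradient h).differentiable two_ne_zero) fun x => ?_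
    rw [← NNReal.coe_le_coe, coe_nnnorm, norm_fderiv_gradient]
    exact ((le_add_of_nonneg_left (norm_nonneg _)).trans (hK x)).trans (Real.le_coe_toNNReal K)
  rw [← lipschitzOnWith_univ] at h2 ⊢
  refine h1.comp h2 fun x _ => ?_
  rw [mem_closedBall_zero_iff]
  exact (le_add_of_nonneg_right (norm_nonneg _)).trans (hK x)

/-- The random variable `∂_i (√|g| g⁻¹)_{ij}(0, h)`. -/
def coefficientDeriv (i j : Fin d) (h : Surface d) : ℝ :=
  fderiv ℝ (fun x => coefficient h x i j) 0 (basisVec i)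

theorem hasDerivAt_coefficient (i j : Fin d) (h : Surface d) :
    HasDerivAt (fun t : ℝ => coefficient h (t • basisVec i) i j) (coefficientDeriv i j h) 0 := by
  have h1 : DifferentiableAt ℝ (fun x => coefficient h x i j) ((0 : ℝ) • basisVec i) :=
    (((contDiff_slopeCoefficient i j).comp
      ((contDiff_gradient h).of_le (by norm_num))).differentiable one_ne_zero).differentiableAt
  have h2 : HasDerivAt (fun t : ℝ => t • basisVec (d := d) i) (basisVec i) 0 := by
    simpa using (hasDerivAt_id (0 : ℝ)).smul_const (basisVec (d := d) i)
  have h3 := h1.hasFDerivAt.comp_hasDerivAt (0 : ℝ) h2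
  rw [zero_smul] at h3
  exact h3

theorem coefficient_translation (h : Surface d) (x : Space d) :
    coefficient (translation x h) 0 = coefficient h x := by
  have h1 : gradient (fun y => translation x h y) 0 = gradient (fun y => h y) x := by
    have : fderiv ℝ (fun y => h (y + x)) 0 = fderiv ℝ (fun y => h y) (0 + x) :=
      fderiv_comp_add_right (f := fun y => h y) x
    rw [zero_add] at this
    simp only [gradient, translation, this]
  simp only [coefficient, surfaceElement, metricTensor, h1]

theorem measurable_coefficient (i j : Fin d) :
    Measurable fun h : Surface d => coefficient h 0 i j :=
  ((continuous_slopeCoefficient i j).comp continuous_slope).measurable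

theorem measurable_coefficientDeriv (i j : Fin d) : Measurable (coefficientDeriv (d := d) i j) := by
  have hlim : ∀ h : Surface d, Tendsto (fun n : ℕ => ((1 / ((n : ℝ) + 1)) : ℝ)⁻¹ •
      (coefficient (translation ((1 / ((n : ℝ) + 1)) • basisVec i) h) 0 i j -
        coefficient h 0 i j)) atTop (𝓝 (coefficientDeriv i j h)) := by
    intro h
    have h1 := (hasDerivAt_iff_tendsto_slope_zero.1 (hasDerivAt_coefficient i j h))
    have h2 : Tendsto (fun n : ℕ => (1 / ((n : ℝ) + 1)) : ℕ → ℝ) atTop (𝓝[≠] 0) :=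
      tendsto_nhdsWithin_iff.2 ⟨tendsto_one_div_add_atTop_nhds_zero_nat,
        Eventually.of_forall fun n => Nat.one_div_pos_of_nat.ne'⟩
    simpa only [Function.comp_def, zero_add, zero_smul, coefficient_translation] using h1.comp h2
  refine measurable_of_tendsto_metrizable (fun n => ?_) (tendsto_pi_nhds.2 hlim)
  exact (((measurable_coefficient i j).comp (continuous_translation _).measurable).sub
    (measurable_coefficient i j)).const_mul (1 / ((n : ℝ) + 1))⁻¹

section Law

variable (P : Measure (Surface d)) [AdmissibleLaw P]

theorem memLp_top_coefficient (i j : Fin d) :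
    MemLp (fun h : Surface d => coefficient h 0 i j) ⊤ P := by
  obtain ⟨K, -, hK⟩ := AdmissibleLaw.boundedDerivatives (P := P)
  obtain ⟨C, hC⟩ := (isCompact_closedBall (0 : Space d) K).exists_bound_of_continuousOn
    (continuous_slopeCoefficient i j).continuousOn
  refine memLp_top_of_bound (measurable_coefficient i j).aestronglyMeasurable C ?_
  filter_upwards [hK] with h hh
  refine hC _ ?_
  rw [mem_closedBall_zero_iff]
  exact le_trans (le_add_of_nonneg_right (norm_nonneg _)) (hh 0)

theorem measurable_surfaceElement : Measurable fun h : Surface d => surfaceElement h 0 := by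
  have hg : Continuous fun p : Space d => Real.sqrt (slopeMetric p).det := by
    simp only [det_slopeMetric]
    fun_prop
  exact (hg.comp continuous_slope).measurable

theorem memLp_top_surfaceElement : MemLp (fun h : Surface d => surfaceElement h 0) ⊤ P := by
  obtain ⟨K, -, hK⟩ := AdmissibleLaw.boundedDerivatives (P := P)
  refine memLp_top_of_bound measurable_surfaceElement.aestronglyMeasurable
    (Real.sqrt (1 + K ^ 2)) ?_
  filter_upwards [hK] with h hh
  rw [surfaceElement, metricTensor, det_slopeMetric, Real.norm_of_nonneg (Real.sqrt_nonneg _)]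
  have h1 : ‖gradient (fun y => h y) (0 : Space d)‖ ≤ K :=
    le_trans (le_add_of_nonneg_right (norm_nonneg _)) (hh 0)
  gcongr

theorem memLp_top_coefficientDeriv (i j : Fin d) : MemLp (coefficientDeriv i j) ⊤ P := by
  obtain ⟨K, -, hK⟩ := AdmissibleLaw.boundedDerivatives (P := P)
  obtain ⟨C, hC⟩ := exists_lipschitzWith_coefficient (d := d) K i j
  refine memLp_top_of_bound (measurable_coefficientDeriv i j).aestronglyMeasurable C ?_
  filter_upwards [hK] with h hh
  refine (ContinuousLinearMap.le_opNorm _ _).trans ?_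
  simpa using norm_fderiv_le_of_lipschitz ℝ (hC h hh)

/-- The entries of `√|g| g⁻¹` as elements of `L²(P)`. -/
def coefficientL2 (i j : Fin d) : L2 P := ((memLp_top_coefficient P i j).mono_exponent le_top).toLp _

/-- The random variables `∂_i (√|g| g⁻¹)_{ij}` as elements of `L²(P)`. -/
def coefficientDerivL2 (i j : Fin d) : L2 P :=
  ((memLp_top_coefficientDeriv P i j).mono_exponent le_top).toLp _

/-- The entry `(√|g| g⁻¹)_{ij}` is differentiable in `L²(P)` along `e_i`: the difference quotients
converge pointwise and are bounded by the Lipschitz constant of the coefficient field. -/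
theorem hasDerivAt_shift_coefficientL2 (i j : Fin d) :
    HasDerivAt (fun t : ℝ => shift P (t • basisVec i) (coefficientL2 P i j))
      (coefficientDerivL2 P i j) 0 := by
  obtain ⟨K, -, hK⟩ := AdmissibleLaw.boundedDerivatives (P := P)
  obtain ⟨C, hC⟩ := exists_lipschitzWith_coefficient (d := d) K i j
  set q : ℝ → Surface d → ℝ := fun t h =>
    t⁻¹ * (coefficient h (t • basisVec i) i j - coefficient h 0 i j) - coefficientDeriv i j h with hq
  have hqm : ∀ t, Measurable (q t) := by
    intro t
    have := ((measurable_coefficient (d := d) i j).comp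
      (continuous_translation (t • basisVec i)).measurable)
    simp only [Function.comp_def, coefficient_translation] at this
    exact ((this.sub (measurable_coefficient i j)).const_mul _).sub
      (measurable_coefficientDeriv i j)
  have hqe : ∀ t, (t⁻¹ • (shift P (t • basisVec i) (coefficientL2 P i j) - coefficientL2 P i j)
      - coefficientDerivL2 P i j : L2 P) =ᵐ[P] q t := by
    intro t
    have hα : coefficientL2 P i j =ᵐ[P] fun h => coefficient h 0 i j := MemLp.coeFn_toLp _
    have hβ : coefficientDerivL2 P i j =ᵐ[P] coefficientDeriv i j := MemLp.coeFn_toLp _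
    have hατ := (measurePreserving_translation P (t • basisVec i)).quasiMeasurePreserving.ae hα
    filter_upwards [hα, hβ, hατ, coeFn_shift P (t • basisVec i) (coefficientL2 P i j),
      Lp.coeFn_sub (t⁻¹ • (shift P (t • basisVec i) (coefficientL2 P i j) - coefficientL2 P i j))
        (coefficientDerivL2 P i j),
      Lp.coeFn_smul t⁻¹ (shift P (t • basisVec i) (coefficientL2 P i j) - coefficientL2 P i j),
      Lp.coeFn_sub (shift P (t • basisVec i) (coefficientL2 P i j)) (coefficientL2 P i j)]
      with h e1 e2 e3 e4 e5 e6 e7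
    rw [e5, Pi.sub_apply, e6, Pi.smul_apply, e7, Pi.sub_apply, e4, e3, e1, e2,
      coefficient_translation, smul_eq_mul]
  have hbound : ∀ᵐ h ∂P, ∀ t : ℝ, |q t h| ≤ 2 * C := by
    filter_upwards [hK] with h hh t
    have h1 : |t⁻¹ * (coefficient h (t • basisVec i) i j - coefficient h 0 i j)| ≤ C := by
      have := (hC h hh).dist_le_mul (t • basisVec i) 0
      rw [Real.dist_eq, dist_zero_right, norm_smul, PiLp.norm_single, norm_one, mul_one,
        Real.norm_eq_abs] at this
      rw [abs_mul, abs_inv]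
      rcases eq_or_ne t 0 with rfl | ht
      · simp
      · rw [inv_mul_le_iff₀ (abs_pos.2 ht), mul_comm]
        exact this
    have h2 : |coefficientDeriv i j h| ≤ C := by
      rw [← Real.norm_eq_abs]
      refine (ContinuousLinearMap.le_opNorm _ _).trans ?_
      simpa using norm_fderiv_le_of_lipschitz ℝ (hC h hh)
    exact (abs_sub _ _).trans (by linarith)
  have hnorm : ∀ t, ‖t⁻¹ • (shift P (t • basisVec i) (coefficientL2 P i j) - coefficientL2 P i j)
      - coefficientDerivL2 P i j‖ ^ 2 = ∫ h, q t h ^ 2 ∂P := by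
    intro t
    rw [← real_inner_self_eq_norm_sq, L2.inner_def]
    refine integral_congr_ae ?_
    filter_upwards [hqe t] with h hh
    rw [hh]
    simp [sq]
  have hlim : Tendsto (fun t => ∫ h, q t h ^ 2 ∂P) (𝓝[≠] 0) (𝓝 (∫ _, (0 : ℝ) ∂P)) := by
    refine tendsto_integral_filter_of_dominated_convergence (fun _ => (2 * (C : ℝ)) ^ 2)
      (Eventually.of_forall fun t => ((hqm t).pow_const 2).aestronglyMeasurable)
      (Eventually.of_forall fun t => ?_) (integrable_const _) (ae_of_all _ fun h => ?_)
    · filter_upwards [hbound] with h hh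
      rw [Real.norm_eq_abs, abs_pow]
      exact pow_le_pow_left₀ (abs_nonneg _) (hh t) 2
    · have h1 := hasDerivAt_iff_tendsto_slope_zero.1 (hasDerivAt_coefficient i j h)
      have h2 := (h1.sub_const (coefficientDeriv i j h)).pow 2
      simpa [hq] using h2
  rw [hasDerivAt_iff_tendsto_slope_zero]
  simp only [zero_add, zero_smul, shift_zero]
  rw [tendsto_iff_norm_sub_tendsto_zero]
  have h3 := hlim.sqrt
  simp only [integral_zero, Real.sqrt_zero, ← hnorm, Real.sqrt_sq (norm_nonneg _)] at h3
  exact h3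

end Law

/-! ### Multiplication operators on `L²(P)` and the weak form of the resolvent equation -/

section Operators

variable (P : Measure (Surface d))

/-- Multiplication by a bounded function, as an operator on `L²(P)`. -/
def mulL2 {f : Surface d → ℝ} (hf : MemLp f ⊤ P) : L2 P →L[ℝ] L2 P :=
  (ContinuousLinearMap.mul ℝ ℝ).holderL P ⊤ 2 2 (hf.toLp f)

theorem coeFn_mulL2 {f : Surface d → ℝ} (hf : MemLp f ⊤ P) (V : L2 P) :
    mulL2 P hf V =ᵐ[P] fun h => f h * V h := by
  have h1 : mulL2 P hf V =ᵐ[P] _ :=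
    (ContinuousLinearMap.mul ℝ ℝ).coeFn_holder (r := 2) (hf.toLp f) V
  filter_upwards [h1, hf.coeFn_toLp] with h e1 e2
  rw [e1, e2]
  rfl

variable [AdmissibleLaw P]

/-- Multiplication by the surface element `√|g|`, an operator on `L²(P)`: up to the factor `Z⁻¹`,
it carries the inner product of `L²(π)`. -/
def areaOp : L2 P →L[ℝ] L2 P := mulL2 P (memLp_top_surfaceElement P)

/-- Multiplication by the matrix field `√|g| g⁻¹`, an operator on `(L²(P))^d`. -/
def coefficientOp : VecL2 P →L[ℝ] VecL2 P :=
  ((PiLp.continuousLinearEquiv 2 ℝ fun _ : Fin d => L2 P).symm : _ →L[ℝ] VecL2 P).comp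
    (ContinuousLinearMap.pi fun i => ∑ j,
      (mulL2 P (memLp_top_coefficient P i j)).comp (PiLp.proj 2 (fun _ : Fin d => L2 P) j))

theorem coefficientOp_apply (V : VecL2 P) (i : Fin d) :
    coefficientOp P V i = ∑ j, mulL2 P (memLp_top_coefficient P i j) (V j) := by
  simp [coefficientOp]

theorem coeFn_coefficientOp (V : VecL2 P) (i : Fin d) :
    coefficientOp P V i =ᵐ[P] fun h => (coefficient h 0 *ᵥ fun j => V j h) i := by
  rw [coefficientOp_apply]
  have h1 : ∀ᵐ h ∂P, ∀ j, mulL2 P (memLp_top_coefficient P i j) (V j) h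
      = coefficient h 0 i j * V j h :=
    ae_all_iff.2 fun j => coeFn_mulL2 P _ (V j)
  filter_upwards [h1, Lp.coeFn_finsetSum Finset.univ
    fun j => mulL2 P (memLp_top_coefficient P i j) (V j)] with h e1 e2
  rw [e2, Finset.sum_apply]
  simp only [e1]
  rfl

theorem inner_coefficientOp (U V : VecL2 P) : inner ℝ U (coefficientOp P V) =
    ∫ h, (fun i => U i h) ⬝ᵥ (coefficient h 0 *ᵥ fun j => V j h) ∂P := by
  simp only [PiLp.inner_apply, L2.inner_def]
  rw [← integral_finsetSum]
  · refine integral_congr_ae ?_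
    filter_upwards [ae_all_iff.2 fun i => coeFn_coefficientOp P V i] with h hh
    simp only [hh, dotProduct]
    exact Finset.sum_congr rfl fun i _ => mul_comm _ _
  · exact fun i _ => L2.integrable_inner _ _

theorem dirichletForm_eq_inner (u v : sobolevH1 P) : dirichletForm P u v =
    (meanArea P)⁻¹ * inner ℝ (coefficientOp P (gradH1 P u)) (gradH1 P v) := by
  rw [dirichletForm_comm, dirichletForm, ← inner_coefficientOp, real_inner_comm]

theorem exists_coercive_coefficientOp : ∃ c : ℝ, 0 < c ∧ ∀ V : VecL2 P,
    c * ‖V‖ ^ 2 ≤ inner ℝ (coefficientOp P V) V := by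
  obtain ⟨K, hK0, hK⟩ := AdmissibleLaw.boundedDerivatives (P := P)
  refine ⟨(2 + K ^ 2)⁻¹, by positivity, fun V => ?_⟩
  have hsq : ‖V‖ ^ 2 = ∫ h, (fun i => V i h) ⬝ᵥ (fun i => V i h) ∂P := by
    rw [← real_inner_self_eq_norm_sq, PiLp.inner_apply]
    simp only [dotProduct, L2.inner_def]
    rw [← integral_finsetSum _ fun i _ => L2.integrable_inner _ _]
    rfl
  rw [inv_mul_le_iff₀ (by positivity), hsq, real_inner_comm, inner_coefficientOp,
    ← integral_const_mul]
  refine integral_mono_of_nonneg (ae_of_all _ fun h => ?_)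
    ((integrable_dirichlet P V V).const_mul _) ?_
  · exact Finset.sum_nonneg fun i _ => mul_self_nonneg _
  · filter_upwards [hK] with h hh
    refine (slopeMetric_elliptic (gradient (fun y => h y) 0) _).trans ?_
    have h1 : ‖gradient (fun y => h y) (0 : Space d)‖ ≤ K :=
      le_trans (le_add_of_nonneg_right (norm_nonneg _)) (hh 0)
    refine mul_le_mul_of_nonneg_right (by gcongr) ?_
    have h2 := (coefficient_posSemidef h 0).dotProduct_mulVec_nonneg (fun i => V i h)
    rw [star_trivial] at h2
    exact h2

theorem one_le_surfaceElement (h : Surface d) (x : Space d) : 1 ≤ surfaceElement h x :=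
  Real.one_le_sqrt.2 (one_le_det_slopeMetric _)

theorem inner_areaOp (u v : L2 P) :
    inner ℝ (areaOp P u) v = ∫ h, surfaceElement h 0 * (u h * v h) ∂P := by
  rw [L2.inner_def]
  refine integral_congr_ae ?_
  filter_upwards [coeFn_mulL2 P (memLp_top_surfaceElement P) u] with h hh
  simp only [areaOp, hh]
  simp only [RCLike.inner_apply, conj_trivial]
  ring

theorem inner_areaOp_comm (u v : L2 P) : inner ℝ (areaOp P u) v = inner ℝ (areaOp P v) u := by
  simp only [inner_areaOp, mul_comm]

theorem norm_sq_le_inner_areaOp (u : L2 P) : ‖u‖ ^ 2 ≤ inner ℝ (areaOp P u) u := by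
  rw [inner_areaOp, ← real_inner_self_eq_norm_sq, L2.inner_def]
  refine integral_mono_of_nonneg (ae_of_all _ fun h => real_inner_self_nonneg) ?_
    (ae_of_all _ fun h => ?_)
  · have h1 : Integrable (fun h => inner ℝ (areaOp P u h) (u h)) P := L2.integrable_inner _ _
    refine h1.congr ?_
    filter_upwards [coeFn_mulL2 P (memLp_top_surfaceElement P) u] with h hh
    simp only [areaOp, hh]
    simp only [RCLike.inner_apply, conj_trivial]
    ring
  · exact le_mul_of_one_le_left (mul_self_nonneg _) (one_le_surfaceElement h 0)

theorem integral_invariantLaw (u v : L2 P) :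
    ∫ h, u h * v h ∂(invariantLaw P) = (meanArea P)⁻¹ * inner ℝ (areaOp P u) v := by
  have hZ := meanArea_pos P
  rw [invariantLaw, integral_withDensity_eq_integral_toReal_smul
    (measurable_surfaceElement.div_const _).ennreal_ofReal
    (ae_of_all _ fun _ => ENNReal.ofReal_lt_top), inner_areaOp, ← integral_const_mul]
  refine integral_congr_ae (ae_of_all _ fun h => ?_)
  have hs : 0 ≤ surfaceElement h 0 := Real.sqrt_nonneg _
  simp only [smul_eq_mul]
  rw [ENNReal.toReal_ofReal (by positivity)]
  ring

theorem isGenerator_iff (u : sobolevH1 P) (w : L2 P) : IsGenerator P u w ↔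
    ∀ φ : sobolevH1 P, -((meanArea P)⁻¹ * inner ℝ (areaOp P w) (φ : L2 P)) =
      dirichletForm P u φ := by
  refine forall_congr' fun φ => ?_
  rw [← integral_invariantLaw, ← integral_neg]
  simp only [neg_mul]

theorem memLp_drift (e : Space d) : MemLp (drift e) 2 P := by
  have hs : MemLp (fun h : Surface d => (surfaceElement h 0)⁻¹) ⊤ P := by
    refine memLp_top_of_bound measurable_surfaceElement.inv.aestronglyMeasurable 1
      (ae_of_all _ fun h => ?_)
    rw [norm_inv, Real.norm_of_nonneg (zero_le_one.trans (one_le_surfaceElement h 0))]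
    exact inv_le_one_of_one_le₀ (one_le_surfaceElement h 0)
  refine memLp_finsetSum (f := fun j h => ((surfaceElement h 0)⁻¹ *
    ∑ i, coefficientDeriv i j h) * e j) _ fun j _ => ?_
  refine MemLp.mul_const ?_ _
  refine MemLp.mul (p := ⊤) (q := 2) ?_ hs
  exact memLp_finsetSum _ fun i _ => (memLp_top_coefficientDeriv P i j).mono_exponent le_top

/-- The drift `F^e` as an element of `L²(P)`. -/
def driftL2 (e : Space d) : L2 P := (memLp_drift P e).toLp _

/-- `√|g| F^e` is the divergence of the field `√|g| g⁻¹ e`. -/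
theorem areaOp_driftL2 (e : Space d) :
    areaOp P (driftL2 P e) = ∑ j, ∑ i, e j • coefficientDerivL2 P i j := by
  ext1
  have h1 : ∀ᵐ h ∂P, ∀ i j, coefficientDerivL2 P i j h = coefficientDeriv i j h :=
    ae_all_iff.2 fun i => ae_all_iff.2 fun j => MemLp.coeFn_toLp _
  have h2 : ∀ᵐ h ∂P, ∀ i j, (e j • coefficientDerivL2 P i j : L2 P) h
      = e j * coefficientDerivL2 P i j h :=
    ae_all_iff.2 fun i => ae_all_iff.2 fun j => Lp.coeFn_smul _ _
  have h3 : ∀ᵐ h ∂P, ∀ j, (∑ i, e j • coefficientDerivL2 P i j : L2 P) h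
      = (∑ i, ⇑(e j • coefficientDerivL2 P i j : L2 P)) h :=
    ae_all_iff.2 fun j => Lp.coeFn_finsetSum _ _
  filter_upwards [coeFn_mulL2 P (memLp_top_surfaceElement P) (driftL2 P e),
    (memLp_drift P e).coeFn_toLp, h1, h2, h3,
    Lp.coeFn_finsetSum Finset.univ fun j => ∑ i, e j • coefficientDerivL2 P i j]
    with h e1 e2 e3 e4 e5 e6
  rw [areaOp, e1, driftL2, e2, e6, drift, Finset.sum_apply, Finset.mul_sum]
  refine Finset.sum_congr rfl fun j _ => ?_
  rw [e5, Finset.sum_apply]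
  simp only [e4, e3, ← Finset.mul_sum]
  have hs : surfaceElement h 0 ≠ 0 := (zero_lt_one.trans_le (one_le_surfaceElement h 0)).ne'
  rw [← mul_assoc, mul_inv_cancel_left₀ hs, mul_comm]
  rfl

theorem coefficientOp_constField (e : Space d) (i : Fin d) :
    coefficientOp P (constField P e) i = ∑ j, e j • coefficientL2 P i j := by
  rw [coefficientOp_apply]
  refine Finset.sum_congr rfl fun j _ => ?_
  ext1
  have hα : coefficientL2 P i j =ᵐ[P] fun h => coefficient h 0 i j := MemLp.coeFn_toLp _
  filter_upwards [coeFn_mulL2 P (memLp_top_coefficient P i j) (constField P e j),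
    Lp.coeFn_const 2 P (e j), hα, Lp.coeFn_smul (e j) (coefficientL2 P i j)] with h e1 e2 e3 e4
  rw [e1, e4, Pi.smul_apply, e3, smul_eq_mul, mul_comm]
  congr 1

/-- Integration by parts: `Z ⟨F^e, φ⟩_{L²(π)} = -⟨√|g| g⁻¹ e, 𝔻 φ⟩`. In particular `F^e` is a
bounded functional for the Dirichlet seminorm. -/
theorem inner_areaOp_driftL2 (e : Space d) (φ : sobolevH1 P) :
    inner ℝ (areaOp P (driftL2 P e)) (φ : L2 P) =
      -inner ℝ (coefficientOp P (constField P e)) (gradH1 P φ) := by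
  rw [areaOp_driftL2, PiLp.inner_apply, Finset.sum_comm, sum_inner, ← Finset.sum_neg_distrib]
  refine Finset.sum_congr rfl fun i _ => ?_
  rw [coefficientOp_constField, sum_inner, sum_inner, ← Finset.sum_neg_distrib]
  refine Finset.sum_congr rfl fun j _ => ?_
  rw [real_inner_smul_left, real_inner_smul_left, real_inner_comm,
    inner_deriv_shift P (hasDerivAt_shift P φ i) (hasDerivAt_shift_coefficientL2 P i j),
    real_inner_comm, mul_neg]

/-- The weak form of `(λ - 𝓛) u = F^e`, with the drift in divergence form. -/
theorem isResolventCorrector_iff (e : Space d) (lam : ℝ) (u : PreHOne P) :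
    IsResolventCorrector P e lam u ↔ ∀ φ : PreHOne P,
      lam * ((meanArea P)⁻¹ * inner ℝ (areaOp P (PreHOne.toH1 P u)) (PreHOne.toH1 P φ : L2 P)) +
        inner ℝ u φ = -((meanArea P)⁻¹ *
          inner ℝ (coefficientOp P (constField P e)) (gradH1 P (PreHOne.toH1 P φ))) := by
  have h1 : IsResolventCorrector P e lam u ↔
      IsGenerator P (PreHOne.toH1 P u) (lam • (PreHOne.toH1 P u : L2 P) - driftL2 P e) := by
    have hae : ∀ w : L2 P, (∀ᵐ h ∂P, lam * (PreHOne.toH1 P u : L2 P) h - w h = drift e h) ↔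
        w = lam • (PreHOne.toH1 P u : L2 P) - driftL2 P e := by
      intro w
      rw [Lp.ext_iff]
      refine eventually_congr ?_
      filter_upwards [Lp.coeFn_sub (lam • (PreHOne.toH1 P u : L2 P)) (driftL2 P e),
        Lp.coeFn_smul lam (PreHOne.toH1 P u : L2 P), (memLp_drift P e).coeFn_toLp] with h e1 e2 e3
      rw [e1, Pi.sub_apply, e2, Pi.smul_apply, smul_eq_mul, driftL2, e3]
      constructor <;> intro h <;> linarith
    constructor
    · rintro ⟨w, hw, hw'⟩
      rwa [(hae w).1 hw'] at hw
    · exact fun h => ⟨_, h, (hae _).2 rfl⟩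
  rw [h1, isGenerator_iff]
  refine forall_congr' fun φ : PreHOne P => ?_
  change -((meanArea P)⁻¹ * inner ℝ _ (PreHOne.toH1 P φ : L2 P)) =
    dirichletForm P (PreHOne.toH1 P u) (PreHOne.toH1 P φ) ↔ _
  have h2 : inner ℝ u φ = dirichletForm P (PreHOne.toH1 P u) (PreHOne.toH1 P φ) := rfl
  have h3 := inner_areaOp_driftL2 P e (PreHOne.toH1 P φ)
  rw [h2, map_sub, map_smul, inner_sub_left, real_inner_smul_left, h3]
  constructor <;> intro h <;> linarith

end Operators

/-! ### Existence of the `λ`-correctors -/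

/-- The Lax–Milgram lemma on a closed subspace. -/
theorem exists_inner_eq_of_coercive {H : Type*} [NormedAddCommGroup H] [InnerProductSpace ℝ H]
    (G : Submodule ℝ H) [CompleteSpace G] (T : H →L[ℝ] H) {c : ℝ} (hc : 0 < c)
    (hT : ∀ x ∈ G, c * ‖x‖ ^ 2 ≤ inner ℝ (T x) x) (f : H) :
    ∃ x ∈ G, ∀ y ∈ G, inner ℝ (T x) y = inner ℝ f y := by
  let B : G →L[ℝ] G →L[ℝ] ℝ := ((ContinuousLinearMap.compL ℝ G H ℝ).flip G.subtypeL).comp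
    ((innerSL ℝ).comp (T.comp G.subtypeL))
  have hB : ∀ x y : G, B x y = inner ℝ (T x) (y : H) := fun x y => rfl
  have hco : IsCoercive B := ⟨c, hc, fun x => by
    rw [hB, mul_assoc, ← sq]
    exact hT x x.2⟩
  refine ⟨hco.continuousLinearEquivOfBilin.symm (G.orthogonalProjectionOnto f), Subtype.coe_prop _,
    fun y hy => ?_⟩
  have h1 := hco.continuousLinearEquivOfBilin_apply
    (hco.continuousLinearEquivOfBilin.symm (G.orthogonalProjectionOnto f)) ⟨y, hy⟩
  rw [ContinuousLinearEquiv.apply_symm_apply, hB] at h1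
  rw [← h1]
  exact Submodule.inner_orthogonalProjectionOnto_eq_of_mem_right ⟨y, hy⟩ f

section Resolvent

variable (P : Measure (Surface d)) [AdmissibleLaw P]

theorem exists_isResolventCorrector (e : Space d) {lam : ℝ} (hlam : 0 < lam) :
    ∃ u : PreHOne P, IsResolventCorrector P e lam u := by
  have hZ : 0 < (meanArea P)⁻¹ := inv_pos.2 (meanArea_pos P)
  obtain ⟨c, hc, hA⟩ := exists_coercive_coefficientOp P
  let T : WithLp 2 (L2 P × VecL2 P) →L[ℝ] WithLp 2 (L2 P × VecL2 P) :=
    ((WithLp.prodContinuousLinearEquiv 2 ℝ (L2 P) (VecL2 P)).symm : _ →L[ℝ] _).comp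
      (((lam * (meanArea P)⁻¹) • (areaOp P).comp (WithLp.fstL 2 ℝ (L2 P) (VecL2 P))).prod
        ((meanArea P)⁻¹ • (coefficientOp P).comp (WithLp.sndL 2 ℝ (L2 P) (VecL2 P))))
  have hT : ∀ x y, inner ℝ (T x) y = lam * (meanArea P)⁻¹ * inner ℝ (areaOp P x.fst) y.fst +
      (meanArea P)⁻¹ * inner ℝ (coefficientOp P x.snd) y.snd := by
    intro x y
    rw [WithLp.prod_inner_apply, ← real_inner_smul_left, ← real_inner_smul_left]
    rfl
  obtain ⟨x, hx, hxy⟩ := exists_inner_eq_of_coercive (sobolevGraph P) T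
    (c := (meanArea P)⁻¹ * min lam c) (by positivity) (fun x _ => by
      rw [hT, WithLp.prod_norm_sq_eq_of_L2]
      have h1 : min lam c * ‖x.fst‖ ^ 2 ≤ lam * inner ℝ (areaOp P x.fst) x.fst :=
        mul_le_mul (min_le_left _ _) (norm_sq_le_inner_areaOp P _) (sq_nonneg _) hlam.le
      have h2 : min lam c * ‖x.snd‖ ^ 2 ≤ inner ℝ (coefficientOp P x.snd) x.snd :=
        (mul_le_mul_of_nonneg_right (min_le_right _ _) (sq_nonneg _)).trans (hA _)
      have h3 := mul_le_mul_of_nonneg_left (add_le_add h1 h2) hZ.le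
      linarith)
    (WithLp.toLp 2 (0, -((meanArea P)⁻¹ • coefficientOp P (constField P e))))
  obtain ⟨u, hu1, hu2⟩ : ∃ u : PreHOne P, (PreHOne.toH1 P u : L2 P) = x.fst ∧
    gradH1 P (PreHOne.toH1 P u) = x.snd := (mem_sobolevGraph P).1 hx
  refine ⟨u, (isResolventCorrector_iff P e lam u).2 fun φ => ?_⟩
  have h1 := hxy (WithLp.toLp 2 ((PreHOne.toH1 P φ : L2 P), gradH1 P (PreHOne.toH1 P φ)))
    ((mem_sobolevGraph P).2 ⟨PreHOne.toH1 P φ, rfl, rfl⟩)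
  rw [hT, ← hu1, ← hu2, WithLp.prod_inner_apply] at h1
  have h2 : inner ℝ u φ = dirichletForm P (PreHOne.toH1 P u) (PreHOne.toH1 P φ) := rfl
  rw [h2, dirichletForm_eq_inner, ← mul_assoc]
  refine h1.trans ?_
  simp [inner_neg_left, real_inner_smul_left]

end Resolvent

/-! ### Convergence of the `λ`-correctors -/

/-- Vanishing regularization: if `b` is bounded below in the sense of `hb` (a semi-inner product has
`b u (u - φ) ≥ -b φ φ / 4`), solutions `u λ` of `λ b (u, ·) + ⟨u, ·⟩ = ⟨χ, ·⟩` converge to `χ`, even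
if `χ` is not in the space on which `b` is defined: the equation is tested with `u λ - φ`, for `φ`
close to `χ`. -/
theorem tendsto_of_regularization {E : Type*} [SeminormedAddCommGroup E] [InnerProductSpace ℝ E]
    (b : E → E → ℝ) (hb : ∀ φ, ∃ C, ∀ u, -C ≤ b u (u - φ)) (χ : UniformSpace.Completion E)
    (u : ℝ → E) (hu : ∀ lam : ℝ, 0 < lam → ∀ φ : E, lam * b (u lam) φ + inner ℝ (u lam) φ =
      inner ℝ χ (φ : UniformSpace.Completion E)) :
    Tendsto (fun lam => (u lam : UniformSpace.Completion E)) (𝓝[>] 0) (𝓝 χ) := by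
  rw [Metric.tendsto_nhds]
  intro ε hε
  obtain ⟨φ, hφ⟩ : ∃ φ : E, dist χ (φ : UniformSpace.Completion E) < ε / 2 :=
    UniformSpace.Completion.denseRange_coe.exists_dist_lt χ (half_pos hε)
  obtain ⟨C, hC⟩ := hb φ
  have hlim : Tendsto (fun lam : ℝ => 2 * lam * C) (𝓝[>] 0) (𝓝 0) := by
    have : Continuous fun lam : ℝ => 2 * lam * C := by fun_prop
    simpa using (this.tendsto 0).mono_left nhdsWithin_le_nhds
  filter_upwards [self_mem_nhdsWithin, hlim.eventually_lt_const (show 0 < ε ^ 2 / 4 by positivity)]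
    with lam hlam hsmall
  set x : UniformSpace.Completion E := (u lam : UniformSpace.Completion E) - χ with hx
  have h1 : inner ℝ x ((u lam - φ : E) : UniformSpace.Completion E) ≤ lam * C := by
    rw [hx, inner_sub_left, UniformSpace.Completion.inner_coe, ← hu lam hlam]
    have := mul_le_mul_of_nonneg_left (hC (u lam)) (le_of_lt hlam)
    linarith
  have h2 : inner ℝ x ((φ : UniformSpace.Completion E) - χ) ≤ ‖x‖ * (ε / 2) := by
    refine (real_inner_le_norm _ _).trans (mul_le_mul_of_nonneg_left ?_ (norm_nonneg _))
    rw [← dist_eq_norm, dist_comm]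
    exact hφ.le
  have h3 : ‖x‖ ^ 2 = inner ℝ x ((u lam - φ : E) : UniformSpace.Completion E) +
      inner ℝ x ((φ : UniformSpace.Completion E) - χ) := by
    rw [← inner_add_right, ← real_inner_self_eq_norm_sq, UniformSpace.Completion.coe_sub,
      sub_add_sub_cancel]
  rw [dist_eq_norm]
  have h4 : ‖x‖ ^ 2 < ε ^ 2 := by nlinarith [sq_nonneg (‖x‖ - ε / 2)]
  exact lt_of_pow_lt_pow_left₀ 2 hε.le h4

section Corrector

variable (P : Measure (Surface d)) [AdmissibleLaw P]

/-- The gradient on `H¹`, as a bounded operator for the Dirichlet seminorm. -/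
def gradPreHOne : PreHOne P →L[ℝ] VecL2 P :=
  ((gradH1 P).comp (PreHOne.toH1 P)).mkContinuousOfExistsBound (exists_gradH1_bound P)

theorem continuous_gradHOne : Continuous (gradHOne P) := UniformSpace.Completion.continuous_extension

theorem inner_coe_HOne (χ : HOne P) (φ : PreHOne P) : inner ℝ χ (φ : HOne P) =
    (meanArea P)⁻¹ * inner ℝ (coefficientOp P (gradHOne P χ)) (gradH1 P (PreHOne.toH1 P φ)) := by
  have hD := continuous_gradHOne P
  induction χ using UniformSpace.Completion.induction_on with
  | hp => exact isClosed_eq (by fun_prop) (by fun_prop)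
  | ih u =>
    rw [UniformSpace.Completion.inner_coe, gradHOne_coe, ← dirichletForm_eq_inner]
    rfl

/-- The corrector problem in weak form, solved by the Riesz representation theorem. -/
theorem exists_weakCorrector (e : Space d) : ∃ χ : HOne P, ∀ φ : PreHOne P,
    inner ℝ χ (φ : HOne P) = -((meanArea P)⁻¹ *
      inner ℝ (coefficientOp P (constField P e)) (gradH1 P (PreHOne.toH1 P φ))) := by
  let l : PreHOne P →L[ℝ] ℝ :=
    -((meanArea P)⁻¹ • (innerSL ℝ (coefficientOp P (constField P e))).comp (gradPreHOne P))
  let L : HOne P →L[ℝ] ℝ := l.extend UniformSpace.Completion.toComplL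
  refine ⟨(InnerProductSpace.toDual ℝ (HOne P)).symm L, fun φ => ?_⟩
  rw [InnerProductSpace.toDual_symm_apply]
  exact l.extend_eq UniformSpace.Completion.denseRange_coe
    (UniformSpace.Completion.isUniformInducing_coe _) φ

/-- All families of `λ`-correctors converge to the solution of the weak corrector problem. -/
theorem tendsto_resolventCorrector (e : Space d) {χ : HOne P}
    (hχ : ∀ φ : PreHOne P, inner ℝ χ (φ : HOne P) = -((meanArea P)⁻¹ *
      inner ℝ (coefficientOp P (constField P e)) (gradH1 P (PreHOne.toH1 P φ))))
    {u : ℝ → PreHOne P} (hu : ∀ lam : ℝ, 0 < lam → IsResolventCorrector P e lam (u lam)) :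
    Tendsto (fun lam => (u lam : HOne P)) (𝓝[>] 0) (𝓝 χ) := by
  refine tendsto_of_regularization (fun u φ => (meanArea P)⁻¹ *
    inner ℝ (areaOp P (PreHOne.toH1 P u)) (PreHOne.toH1 P φ : L2 P)) (fun φ => ?_) χ u
    fun lam hlam φ => ?_
  · -- complete the square: `⟨u, u - φ⟩ = ‖u - φ / 2‖² - ‖φ‖² / 4` in `L²(π)`
    refine ⟨(meanArea P)⁻¹ * (1 / 4 * inner ℝ (areaOp P (PreHOne.toH1 P φ))
      (PreHOne.toH1 P φ : L2 P)), fun u => ?_⟩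
    rw [← mul_neg]
    refine mul_le_mul_of_nonneg_left ?_ (inv_nonneg.2 (meanArea_pos P).le)
    rw [map_sub, Submodule.coe_sub]
    generalize (PreHOne.toH1 P u : L2 P) = v
    generalize (PreHOne.toH1 P φ : L2 P) = ψ
    have h1 := (sq_nonneg _).trans (norm_sq_le_inner_areaOp P (v - (1 / 2 : ℝ) • ψ))
    have h2 := inner_areaOp_comm P ψ v
    simp only [map_sub, map_smul, inner_sub_left, inner_sub_right, real_inner_smul_left,
      real_inner_smul_right] at h1 ⊢
    linarith
  · rw [hχ]
    exact (isResolventCorrector_iff P e lam (u lam)).1 (hu lam hlam) φ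

theorem isCorrector_iff (e : Space d) (χ : HOne P) : IsCorrector P e χ ↔
    ∀ φ : PreHOne P, inner ℝ χ (φ : HOne P) = -((meanArea P)⁻¹ *
      inner ℝ (coefficientOp P (constField P e)) (gradH1 P (PreHOne.toH1 P φ))) := by
  constructor
  · rintro ⟨u, hu, hlim⟩
    obtain ⟨χ', hχ'⟩ := exists_weakCorrector P e
    rwa [tendsto_nhds_unique hlim (tendsto_resolventCorrector P e hχ' hu)]
  · intro hχ
    choose! u hu using fun (lam : ℝ) (hlam : 0 < lam) => exists_isResolventCorrector P e hlam
    exact ⟨u, hu, tendsto_resolventCorrector P e hχ hu⟩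

theorem existsUnique_isCorrector (e : Space d) : ∃! χ : HOne P, IsCorrector P e χ := by
  obtain ⟨χ, hχ⟩ := exists_weakCorrector P e
  refine ⟨χ, (isCorrector_iff P e χ).2 hχ, ?_⟩
  rintro χ' ⟨u, hu, hlim⟩
  exact tendsto_nhds_unique hlim (tendsto_resolventCorrector P e hχ hu)

/-! ### The cell problem -/

theorem mem_orthogonal_L2pot_iff (W : VecL2 P) :
    W ∈ (L2pot P)ᗮ ↔ ∀ φ : sobolevH1 P, inner ℝ W (gradH1 P φ) = 0 := by
  rw [L2pot, Submodule.orthogonal_closure, Submodule.mem_orthogonal']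
  refine ⟨fun h φ => h _ ⟨φ, rfl⟩, ?_⟩
  rintro h _ ⟨φ, rfl⟩
  exact h φ

theorem L2const_le_orthogonal_L2pot : L2const P ≤ (L2pot P)ᗮ := by
  rw [L2const, Submodule.span_le]
  rintro _ ⟨i, rfl⟩
  rw [SetLike.mem_coe, mem_orthogonal_L2pot_iff]
  intro φ
  rw [PiLp.inner_apply]
  exact Finset.sum_eq_zero fun j _ => inner_const_gradH1 P φ j _

/-- `L²_div ⊕ L²_c` is the orthogonal complement of the potential fields, since these are orthogonal
to the constant ones. -/
theorem L2div_sup_L2const : L2div P ⊔ L2const P = (L2pot P)ᗮ := by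
  have : FiniteDimensional ℝ (L2const P) := FiniteDimensional.span_of_finite ℝ (Set.finite_range _)
  rw [L2div, ← Submodule.inf_orthogonal, sup_comm]
  exact Submodule.sup_orthogonal_inf_of_hasOrthogonalProjection (L2const_le_orthogonal_L2pot P)

theorem isCellSolution_iff (e : Space d) (V : VecL2 P) : IsCellSolution P e V ↔
    V ∈ L2pot P ∧ ∀ φ : sobolevH1 P,
      inner ℝ (coefficientOp P (constField P e + V)) (gradH1 P φ) = 0 := by
  rw [IsCellSolution, L2div_sup_L2const, ← mem_orthogonal_L2pot_iff]
  refine and_congr_right fun _ => ?_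
  have hcoe : ∀ i, coefficientOp P (constField P e + V) i =ᵐ[P]
      fun h => (coefficient h 0 *ᵥ fun j => e j + V j h) i := by
    intro i
    have h1 : ∀ᵐ h ∂P, ∀ j, (constField P e + V) j h = e j + V j h := by
      refine ae_all_iff.2 fun j => ?_
      filter_upwards [Lp.coeFn_add (constField P e j) (V j), Lp.coeFn_const 2 P (e j)] with h e1 e2
      rw [PiLp.add_apply, e1, Pi.add_apply]
      exact congrArg (· + V j h) e2
    filter_upwards [coeFn_coefficientOp P (constField P e + V) i, h1] with h e1 e2
    rw [e1]
    simp only [e2]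
  constructor
  · rintro ⟨W, hW, hWe⟩
    have : W = coefficientOp P (constField P e + V) := by
      ext1 i
      ext1
      filter_upwards [hWe i, hcoe i] with h e1 e2
      rw [e1, e2]
    rwa [← this]
  · exact fun h => ⟨_, h, hcoe⟩

theorem gradHOne_mem_L2pot (χ : HOne P) : gradHOne P χ ∈ L2pot P := by
  induction χ using UniformSpace.Completion.induction_on with
  | hp => exact (Submodule.isClosed_topologicalClosure _).preimage (continuous_gradHOne P)
  | ih u =>
    rw [gradHOne_coe]
    exact Submodule.le_topologicalClosure _ ⟨_, rfl⟩

theorem IsCorrector.isCellSolution {e : Space d} {χ : HOne P} (hχ : IsCorrector P e χ) :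
    IsCellSolution P e (gradHOne P χ) := by
  refine (isCellSolution_iff P e _).2 ⟨gradHOne_mem_L2pot P χ, fun φ => ?_⟩
  have h1 := (inner_coe_HOne P χ φ).symm.trans ((isCorrector_iff P e χ).1 hχ φ)
  have h2 : inner ℝ (coefficientOp P (gradHOne P χ)) (gradH1 P φ) =
      -inner ℝ (coefficientOp P (constField P e)) (gradH1 P φ) :=
    mul_left_cancel₀ (inv_pos.2 (meanArea_pos P)).ne' (h1.trans (mul_neg _ _).symm)
  rw [map_add, inner_add_left, h2, add_neg_cancel]

/-- Uniqueness for the cell problem: the difference `V - V'` of two solutions is a potential field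
and `√|g| g⁻¹ (V - V')` is orthogonal to all of these. -/
theorem IsCellSolution.eq {e : Space d} {V V' : VecL2 P} (hV : IsCellSolution P e V)
    (hV' : IsCellSolution P e V') : V = V' := by
  obtain ⟨hp, ho⟩ := (isCellSolution_iff P e V).1 hV
  obtain ⟨hp', ho'⟩ := (isCellSolution_iff P e V').1 hV'
  have h1 : coefficientOp P (V - V') ∈ (L2pot P)ᗮ := by
    rw [mem_orthogonal_L2pot_iff]
    intro φ
    rw [← add_sub_add_left_eq_sub V V' (constField P e), map_sub, inner_sub_left, ho, ho', sub_zero]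
  have h2 : inner ℝ (coefficientOp P (V - V')) (V - V') = 0 :=
    Submodule.inner_left_of_mem_orthogonal ((L2pot P).sub_mem hp hp') h1
  obtain ⟨c, hc, hA⟩ := exists_coercive_coefficientOp P
  have h3 := hA (V - V')
  rw [h2] at h3
  have h4 : ‖V - V'‖ ^ 2 = 0 := le_antisymm (by nlinarith) (sq_nonneg _)
  rwa [sq_eq_zero_iff, norm_eq_zero, sub_eq_zero] at h4

end Corrector

end RandomSurface

end

theorem proposition5p1 {d : ℕ} (P : Measure (Surface d)) [AdmissibleLaw P]
    (e : Space d) (he : ‖e‖ = 1) :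
    (∃! χ : HOne P, IsCorrector P e χ) ∧
    ∀ χ : HOne P, IsCorrector P e χ →
      IsCellSolution P e (gradHOne P χ) ∧
      ∀ V : VecL2 P, IsCellSolution P e V → V = gradHOne P χ := by
  refine ⟨existsUnique_isCorrector P e, fun χ hχ => ⟨hχ.isCellSolution P, fun V hV => ?_⟩⟩
  exact hV.eq P (hχ.isCellSolution P)
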